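/- Consider a setting with a finite set $N$ of $n$ agents, a finite set $M$ of $m$ objects, and capacities $q_j \in \mathbb{N}$ (the number of indivisible units of object $j \in M$), where $n \le \sum_{j\in M} q_j$. An allocation is a matrix $(x_{i,j})_{i\in N,\,j\in M}$ with entries in $[0,1]$ such that $\sum_{j} x_{i,j} = 1$ for every agent $i$ and $\sum_{i} x_{i,j} \le q_j$ for every object $j$. A mechanism $f$ maps every profile $\mathbf{t}=(t_i,t_{-i})$ of strict preference orderings over $M$, one for each agent, to an allocation; $f_i(t_i,t_{-i})(j)$ denotes the share of object $j$ that agent $i$ receives. The Probabilistic Serial mechanism $\mathrm{PS}$ is the outcome of the simultaneous eating algorithm: starting at time $0$ with $q_j$ units of each object $j$, at every point in time each agent consumes, at speed $1$, the object that is ranked highest in its reported ordering among the objects that are not yet exhausted; the algorithm ends at time $1$, and $\mathrm{PS}_i(t_i,t_{-i})(j)$ is the amount of object $j$ that agent $i$ has consumed. **Proposition.** In every such setting, $\mathrm{PS}$ is swap monotonic. That is, let $i \in N$ be any agent, let $(t_i,t_{-i})$ be any profile of orderings, and let $t_i'$ be any ordering that differs from $t_i$ only by a swap of two adjacent objects $a$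 and $b$, where $a \succ b$ under $t_i$ and $b \succ a$ under $t_i'$. Then either $\mathrm{PS}_i(t_i',t_{-i})(j) = \mathrm{PS}_i(t_i,t_{-i})(j)$ for all $j \in M$, or $$\mathrm{PS}_i(t_i',t_{-i})(b) > \mathrm{PS}_i(t_i,t_{-i})(b) \quad\text{and}\quad \mathrm{PS}_i(t_i',t_{-i})(a) < \mathrm{PS}_i(t_i,t_{-i})(a).$$ -/

import Mathlib

namespace OneSidedMatching

/-- A setting: agents `N`, objects `M`, and `cap j` units of each object `j`, where supply satisfies
demand. Capacities are numbers of indivisible units, hence natural numbers. -/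
structure Setting (N M : Type*) [Fintype N] [Fintype M] where
  cap : M → ℕ
  supply : Fintype.card N ≤ ∑ j, cap j

/-- An allocation: `share i j` is the probability with which agent `i` gets object `j`. -/
structure Allocation {N M : Type*} [Fintype N] [Fintype M] (S : Setting N M) where
  share : N → M → ℝ
  nonneg : ∀ i j, 0 ≤ share i j
  le_one : ∀ i j, share i j ≤ 1
  fulfillment : ∀ i, ∑ j, share i j = 1
  capacity : ∀ j, ∑ i, share i j ≤ (S.cap j : ℝ)

/-- A strict preference ordering `a₁ ≻ a₂ ≻ … ≻ aₘ` of all the objects, as the list of objects by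
rank: `t k` is the object in position `k` (position `0` is the most preferred one). -/
abbrev PrefOrder (M : Type*) [Fintype M] := Fin (Fintype.card M) ≃ M

/-- `a ≻ b` under `t`. -/
def Prefers {M : Type*} [Fintype M] (t : PrefOrder M) (a b : M) : Prop :=
  t.symm a < t.symm b

/-- The neighborhood of `t`: all orderings that arise from `t` by swapping the objects in two
consecutive positions `k`, `k + 1`. -/
def neighborhood {M : Type*} [Fintype M] (t : PrefOrder M) : Set (PrefOrder M) :=
  {t' | ∃ (k : ℕ) (hk : k + 1 < Fintype.card M),
    t' = (Equiv.swap (⟨k, Nat.lt_of_succ_lt hk⟩ : Fin (Fintype.card M)) ⟨k + 1, hk⟩).trans t}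

/-- An (ordinal) mechanism maps each profile of reported orderings to an allocation. -/
abbrev Mechanism {N M : Type*} [Fintype N] [Fintype M] (S : Setting N M) :=
  (N → PrefOrder M) → Allocation S

open Classical in
/-- Swap monotonicity: if agent `i` changes its report from `t i` to a neighboring `t'`, which
reverses `a ≻ b` to `b ≻ a`, then either the whole allocation of `i` is unaffected, or `i`'s share
of `a` strictly decreases and its share of `b` strictly increases. -/
def SwapMonotonic {N M : Type*} [Fintype N] [Fintype M] {S : Setting N M}
    (f : Mechanism S) : Prop :=
  ∀ (i : N) (t : N → PrefOrder M), ∀ t' ∈ neighborhood (t i), ∀ a b : M,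
    Prefers (t i) a b → Prefers t' b a →
      (f t).share i = (f (Function.update t i t')).share i ∨
      ((f (Function.update t i t')).share i a < (f t).share i a ∧
        (f t).share i b < (f (Function.update t i t')).share i b)

section Eating

variable {N M : Type*} [Fintype N] [Fintype M] (S : Setting N M) (t : N → PrefOrder M)

/-- A stage of the simultaneous eating algorithm: the current time and the amount of each object
that each agent has consumed so far. -/
structure EatingState (N M : Type*) where
  time : ℝ
  eaten : N → M → ℝ

/-- The amount of object `j` that has not been consumed yet. -/
def remaining (s : EatingState N M) (j : M) : ℝ := (S.cap j : ℝ) - ∑ i, s.eaten i j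

/-- Agent `i` is currently eating object `j`: it is the agent's most preferred object among those
that are not exhausted. -/
def IsEating (s : EatingState N M) (i : N) (j : M) : Prop :=
  0 < remaining S s j ∧ ∀ k, 0 < remaining S s k → k = j ∨ Prefers (t i) j k

open Classical in
/-- The finite set of agents who are currently eating object `j`. -/
noncomputable def eaters (s : EatingState N M) (j : M) : Finset N :=
  Finset.univ.filter fun i => IsEating S t s i j

open Classical in
/-- The length of the current phase: all agents eat at unit speed, until an object that is being
eaten is exhausted, or until time `1`, whichever comes first. -/
noncomputable def phaseLength (s : EatingState N M) : ℝ :=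
  (insert (1 - s.time)
    ((Finset.univ.filter fun j => (eaters S t s j).Nonempty).image
      fun j => remaining S s j / ((eaters S t s j).card : ℝ))).min' (Finset.insert_nonempty _ _)

open Classical in
/-- One phase of the simultaneous eating algorithm. -/
noncomputable def eatingStep (s : EatingState N M) : EatingState N M where
  time := s.time + phaseLength S t s
  eaten i j := s.eaten i j + if IsEating S t s i j then phaseLength S t s else 0

/-- The state of the simultaneous eating algorithm after `k` phases. -/
noncomputable def eatingState (k : ℕ) : EatingState N M :=
  (eatingStep S t)^[k] ⟨0, fun _ _ => 0⟩

/-! Each phase ends at time `1` or exhausts an object, so the algorithm has stopped after as many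
phases as there are objects; what follows checks that the result is an allocation. -/

variable {S t}

/-- The invariant of the algorithm. -/
structure EatingState.Valid (S : Setting N M) (s : EatingState N M) : Prop where
  time_le : s.time ≤ 1
  nonneg : ∀ i j, 0 ≤ s.eaten i j
  sum_eq : ∀ i, ∑ j, s.eaten i j = s.time
  remaining_nonneg : ∀ j, 0 ≤ remaining S s j

theorem IsEating.unique {s : EatingState N M} {i : N} {j k : M}
    (hj : IsEating S t s i j) (hk : IsEating S t s i k) : j = k := by
  rcases hj.2 k hk.1 with h | h
  · exact h.symm
  · rcases hk.2 j hj.1 with h' | h'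
    · exact h'
    · exact absurd h (lt_asymm h')

theorem exists_isEating {s : EatingState N M} (h : ∃ j, 0 < remaining S s j) (i : N) :
    ∃ j, IsEating S t s i j := by
  classical
  obtain ⟨j₀, hj₀⟩ := h
  obtain ⟨j, hj, hmin⟩ := Finset.exists_min_image
    (Finset.univ.filter fun j => 0 < remaining S s j) (t i).symm ⟨j₀, by simpa using hj₀⟩
  refine ⟨j, by simpa using hj, fun k hk => ?_⟩
  rcases (hmin k (by simpa using hk)).eq_or_lt with h | h
  · exact Or.inl ((t i).symm.injective h.symm)
  · exact Or.inr h

theorem phaseLength_le_time (s : EatingState N M) : phaseLength S t s ≤ 1 - s.time :=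
  Finset.min'_le _ _ (Finset.mem_insert_self _ _)

theorem phaseLength_mul_le (s : EatingState N M) {j : M} (h : (eaters S t s j).Nonempty) :
    ((eaters S t s j).card : ℝ) * phaseLength S t s ≤ remaining S s j := by
  classical
  have hc : (0 : ℝ) < (eaters S t s j).card := by exact_mod_cast h.card_pos
  have : phaseLength S t s ≤ remaining S s j / ((eaters S t s j).card : ℝ) := by
    refine Finset.min'_le _ _ (Finset.mem_insert_of_mem (Finset.mem_image.2 ⟨j, ?_, rfl⟩))
    simpa using h
  rw [le_div_iff₀ hc] at this
  linarith

theorem phaseLength_cases (s : EatingState N M) :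
    phaseLength S t s = 1 - s.time ∨ ∃ j, (eaters S t s j).Nonempty ∧
      ((eaters S t s j).card : ℝ) * phaseLength S t s = remaining S s j := by
  classical
  have h : phaseLength S t s ∈ _ := Finset.min'_mem _ (Finset.insert_nonempty _ _)
  rcases Finset.mem_insert.1 h with h | h
  · exact Or.inl h
  · obtain ⟨j, hj, hjs⟩ := Finset.mem_image.1 h
    have hne : (eaters S t s j).Nonempty := by simpa using hj
    have hc : ((eaters S t s j).card : ℝ) ≠ 0 := by exact_mod_cast hne.card_pos.ne'
    exact Or.inr ⟨j, hne, by rw [← hjs]; field_simp⟩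

theorem phaseLength_nonneg {s : EatingState N M} (hs : s.Valid S) : 0 ≤ phaseLength S t s := by
  rcases phaseLength_cases (S := S) (t := t) s with h | ⟨j, hne, h⟩
  · linarith [hs.time_le]
  · have hc : (0 : ℝ) < (eaters S t s j).card := by exact_mod_cast hne.card_pos
    by_contra hn
    have := mul_neg_of_pos_of_neg hc (not_le.1 hn)
    linarith [hs.remaining_nonneg j]

theorem remaining_eatingStep (s : EatingState N M) (j : M) :
    remaining S (eatingStep S t s) j =
      remaining S s j - ((eaters S t s j).card : ℝ) * phaseLength S t s := by
  classical
  simp only [remaining, eatingStep, eaters, Finset.sum_add_distrib, ← Finset.sum_filter,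
    Finset.sum_const, nsmul_eq_mul]
  rw [sub_sub]

theorem EatingState.Valid.time_eq {s : EatingState N M} (hs : s.Valid S) [Nonempty N]
    (h : ¬ ∃ j, 0 < remaining S s j) : s.time = 1 := by
  have h1 : ∀ j, ∑ i, s.eaten i j = (S.cap j : ℝ) := fun j => by
    have := le_antisymm (not_lt.1 (not_exists.1 h j)) (hs.remaining_nonneg j)
    simp only [remaining] at this
    linarith
  have h2 : ∑ j, (S.cap j : ℝ) = Fintype.card N * s.time := by
    rw [← Finset.sum_congr rfl fun j _ => h1 j, Finset.sum_comm]
    simp [hs.sum_eq]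
  have h3 : (Fintype.card N : ℝ) ≤ ∑ j, (S.cap j : ℝ) := by exact_mod_cast S.supply
  have h4 : (0 : ℝ) < Fintype.card N := by exact_mod_cast Fintype.card_pos
  have h5 := hs.time_le
  nlinarith

theorem EatingState.Valid.step {s : EatingState N M} (hs : s.Valid S) :
    (eatingStep S t s).Valid S where
  time_le := by
    have := phaseLength_le_time (S := S) (t := t) s
    simp only [eatingStep]
    linarith
  nonneg i j := by
    have := phaseLength_nonneg (t := t) hs
    have := hs.nonneg i j
    simp only [eatingStep]
    split_ifs <;> linarith
  sum_eq i := by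
    classical
    simp only [eatingStep, Finset.sum_add_distrib, hs.sum_eq]
    congr 1
    by_cases h : ∃ j, 0 < remaining S s j
    · obtain ⟨j, hj⟩ := exists_isEating (t := t) h i
      rw [Finset.sum_eq_single j]
      · simp [hj]
      · intro k _ hk
        rw [if_neg fun hk' => hk (hk'.unique hj)]
      · simp
    · have : Nonempty N := ⟨i⟩
      have h1 := hs.time_eq h
      have h2 : phaseLength S t s = 0 := le_antisymm
        (by linarith [phaseLength_le_time (S := S) (t := t) s]) (phaseLength_nonneg hs)
      simp [h2]
  remaining_nonneg j := by
    rw [remaining_eatingStep]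
    rcases (eaters S t s j).eq_empty_or_nonempty with h | h
    · simpa [h] using hs.remaining_nonneg j
    · linarith [phaseLength_mul_le s h]

variable (S t)

theorem eatingState_succ (k : ℕ) :
    eatingState S t (k + 1) = eatingStep S t (eatingState S t k) :=
  Function.iterate_succ_apply' _ _ _

theorem eatingState_valid (k : ℕ) : (eatingState S t k).Valid S := by
  induction k with
  | zero => exact ⟨by simp [eatingState], by simp [eatingState], by simp [eatingState],
      by simp [eatingState, remaining]⟩
  | succ k ih => rw [eatingState_succ]; exact ih.step

open Classical in
theorem eatingState_progress (k : ℕ) : (eatingState S t k).time = 1 ∨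
    (Finset.univ.filter fun j => 0 < remaining S (eatingState S t k) j).card + k
      ≤ Fintype.card M := by
  induction k with
  | zero => exact Or.inr (Finset.card_le_univ _)
  | succ k ih =>
    rw [eatingState_succ]
    have hs := eatingState_valid S t k
    set s := eatingState S t k
    have hp := phaseLength_nonneg (t := t) hs
    rcases ih with ih | ih
    · left
      have := phaseLength_le_time (S := S) (t := t) s
      simp only [eatingStep]
      linarith
    rcases phaseLength_cases (S := S) (t := t) s with h | ⟨j, hne, h⟩
    · left
      simp only [eatingStep]
      linarith
    · right
      obtain ⟨i, hi⟩ := hne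
      have hi' : IsEating S t s i j := by simpa [eaters] using hi
      have hlt : (Finset.univ.filter fun j => 0 < remaining S (eatingStep S t s) j).card
          < (Finset.univ.filter fun j => 0 < remaining S s j).card := by
        refine Finset.card_lt_card (Finset.ssubset_iff_of_subset ?_ |>.2 ⟨j, ?_, ?_⟩)
        · intro l
          simp only [Finset.mem_filter, Finset.mem_univ, true_and, remaining_eatingStep]
          intro hl
          have : 0 ≤ ((eaters S t s l).card : ℝ) * phaseLength S t s := by positivity
          linarith
        · simpa using hi'.1
        · simp [remaining_eatingStep, h]
      omega

theorem eatingState_time [Nonempty N] : (eatingState S t (Fintype.card M)).time = 1 := by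
  classical
  rcases eatingState_progress S t (Fintype.card M) with h | h
  · exact h
  · refine (eatingState_valid S t _).time_eq ?_
    rintro ⟨j, hj⟩
    have : 0 < (Finset.univ.filter fun j =>
        0 < remaining S (eatingState S t (Fintype.card M)) j).card :=
      Finset.card_pos.2 ⟨j, by simpa using hj⟩
    omega

end Eating

/-- The Probabilistic Serial mechanism: the outcome of the simultaneous eating algorithm. -/
noncomputable def probabilisticSerial {N M : Type*} [Fintype N] [Fintype M] (S : Setting N M) :
    Mechanism S := fun t =>
  have sum_eq (i : N) : ∑ j, (eatingState S t (Fintype.card M)).eaten i j = 1 := by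
    have : Nonempty N := ⟨i⟩
    rw [(eatingState_valid S t _).sum_eq, eatingState_time]
  { share := (eatingState S t (Fintype.card M)).eaten
    nonneg := (eatingState_valid S t _).nonneg
    le_one := fun i j => by
      rw [← sum_eq i]
      exact Finset.single_le_sum (fun k _ => (eatingState_valid S t _).nonneg i k)
        (Finset.mem_univ j)
    fulfillment := sum_eq
    capacity := fun j => sub_nonneg.1 ((eatingState_valid S t _).remaining_nonneg j) }

end OneSidedMatching

namespace OneSidedMatching

/-! The eating algorithm is replaced by a static description, `ExhaustionTimes`: an agent eats an
object from the moment all better ones are gone until it is gone itself. The algorithm produces such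
times (`exists_exhaustionTimes`), and they determine the outcome (`share_unique`). The main tool is
`time_le_time`: at an earliest object exhausted later under `τ` than under `τ'`, all its eaters
under `τ'` get strictly more under `τ`, which exceeds the capacity.

For a swap of `a` and `b` by agent `i`, the question is whether at some moment everything above `a`
is gone while `a` and `b` both remain (`Competing`). If not, the old times and shares also fit the
new profile (`of_not_competing`), so by uniqueness nothing changes. If so, `i` gets strictly more of
`b` (`share_lt_of_competing`). Competition persists after the swap with `a` and `b` exchanged
(`competing_symm`), so the same lemma applied to the reverse swap gives the strict loss of `a`. -/

variable {N M : Type*} [Fintype N] [Fintype M]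

/-! ### Exhaustion times of the eating algorithm -/

/-- `τ` is a vector of exhaustion times (truncated at `T`) for the consumption matrix `x`: agent `i`
eats `j` from the time when everything that `i` prefers to `j` is exhausted until `j` is exhausted,
and an object exhausted before time `T` is completely consumed. -/
structure ExhaustionTimes (S : Setting N M) (u : N → PrefOrder M) (T : ℝ) (x : N → M → ℝ)
    (τ : M → ℝ) : Prop where
  time_nonneg : ∀ j, 0 ≤ τ j
  time_le : ∀ j, τ j ≤ T
  nonneg : ∀ i j, 0 ≤ x i j
  le_time : ∀ i j, x i j ≤ τ j
  le_sub : ∀ i j k, Prefers (u i) k j → 0 < x i j → x i j ≤ τ j - τ k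
  sub_le : ∀ i j c, 0 ≤ c → (∀ k, Prefers (u i) k j → τ k ≤ c) → τ j - c ≤ x i j
  sum_le : ∀ j, ∑ i, x i j ≤ (S.cap j : ℝ)
  sum_eq : ∀ j, τ j < T → ∑ i, x i j = (S.cap j : ℝ)
  eq_zero : ∀ j, S.cap j = 0 → τ j = 0

theorem remaining_pos_of_step {S : Setting N M} {t : N → PrefOrder M} {s : EatingState N M}
    (hs : s.Valid S) {j : M} (h : 0 < remaining S (eatingStep S t s) j) :
    0 < remaining S s j := by
  rw [remaining_eatingStep] at h
  have := phaseLength_nonneg (t := t) hs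
  have : 0 ≤ ((eaters S t s j).card : ℝ) * phaseLength S t s := by positivity
  linarith

/-- Induction on phases: an object that is still available at the start of a phase has its time
extended by the phase length, and all other times are frozen. The second conjunct, that available
objects carry the current time, is what keeps the induction going. -/
theorem exists_exhaustionTimes (S : Setting N M) (t : N → PrefOrder M) (n : ℕ) :
    ∃ τ, ExhaustionTimes S t (eatingState S t n).time (eatingState S t n).eaten τ ∧
      ∀ j, 0 < remaining S (eatingState S t n) j → τ j = (eatingState S t n).time := by
  classical
  induction n with
  | zero =>
    refine ⟨fun _ => 0, ?_, fun _ _ => rfl⟩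
    constructor <;> simp +contextual [eatingState]
  | succ n ih =>
    obtain ⟨τ, hτ, hr⟩ := ih
    have hv' := eatingState_valid S t (n + 1)
    rw [eatingState_succ] at hv' ⊢
    have hs := eatingState_valid S t n
    set s := eatingState S t n
    have hl := phaseLength_nonneg (t := t) hs
    set l := phaseLength S t s
    have htime : (eatingStep S t s).time = s.time + l := rfl
    have heat : ∀ i j, (eatingStep S t s).eaten i j =
        s.eaten i j + if IsEating S t s i j then l else 0 := fun _ _ => rfl
    have hpos : ∀ j, 0 < remaining S s j →
        τ j + (if 0 < remaining S s j then l else 0) = s.time + l := fun j hj => by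
      rw [if_pos hj, hr j hj]
    have hzero : ∀ j, ¬ 0 < remaining S s j →
        τ j + (if 0 < remaining S s j then l else 0) = τ j := fun j hj => by
      rw [if_neg hj, add_zero]
    have hge : ∀ j, τ j ≤ τ j + (if 0 < remaining S s j then l else 0) := fun j => by
      split_ifs <;> linarith
    refine ⟨fun j => τ j + if 0 < remaining S s j then l else 0, ?_, fun j hj => ?_⟩
    · refine ⟨fun j => (hτ.time_nonneg j).trans (hge j), fun j => ?_, hv'.nonneg, fun i j => ?_,
        fun i j k hk hx => ?_, fun i j c hc h => ?_, fun j => ?_, fun j hj => ?_, fun j hj => ?_⟩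
      · have := hτ.time_le j
        split_ifs <;> linarith
      · have := hτ.le_time i j
        rw [heat]
        by_cases he : IsEating S t s i j
        · simp only [if_pos he, if_pos he.1]; linarith
        · rw [if_neg he]; linarith [hge j]
      · rw [heat] at hx ⊢
        by_cases he : IsEating S t s i j
        · have hk' : ¬ 0 < remaining S s k := fun h => by
            rcases he.2 k h with rfl | h'
            · exact lt_irrefl _ hk
            · exact lt_asymm hk h'
          rw [hzero k hk', hpos j he.1, if_pos he]
          by_cases hx0 : 0 < s.eaten i j
          · linarith [hτ.le_sub i j k hk hx0, hr j he.1]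
          · linarith [hτ.time_le k]
        · rw [if_neg he, add_zero] at hx ⊢
          have h1 := hτ.le_sub i j k hk hx
          have hk' : ¬ 0 < remaining S s k := fun h => by
            linarith [hr k h, hτ.time_le j]
          rw [hzero k hk']
          linarith [hge j]
      · have hle : ∀ k, Prefers (t i) k j → τ k ≤ c := fun k hk => (hge k).trans (h k hk)
        have h1 := hτ.sub_le i j c hc hle
        rw [heat]
        by_cases he : IsEating S t s i j
        · rw [if_pos he, if_pos he.1]; linarith
        · rw [if_neg he]
          by_cases hj : 0 < remaining S s j
          · have : ∃ k, 0 < remaining S s k ∧ Prefers (t i) k j := by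
              by_contra! hcon
              refine he ⟨hj, fun k hk => ?_⟩
              rcases lt_trichotomy ((t i).symm j) ((t i).symm k) with h' | h' | h'
              · exact Or.inr h'
              · exact Or.inl ((t i).symm.injective h').symm
              · exact absurd h' (hcon k hk)
            obtain ⟨k, hk, hkj⟩ := this
            have h2 := h k hkj
            rw [hpos k hk] at h2
            rw [hpos j hj]
            linarith [hτ.nonneg i j]
          · rw [hzero j hj]; linarith
      · exact sub_nonneg.1 (hv'.remaining_nonneg j)
      · by_contra hne
        have h1 : 0 < remaining S (eatingStep S t s) j :=
          lt_of_le_of_ne (hv'.remaining_nonneg j) fun h => hne (sub_eq_zero.1 h.symm).symm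
        rw [hpos j (remaining_pos_of_step hs h1), htime] at hj
        exact lt_irrefl _ hj
      · have h1 : ¬ 0 < remaining S s j := by
          have : 0 ≤ ∑ i, s.eaten i j := Finset.sum_nonneg fun i _ => hs.nonneg i j
          simp only [remaining, hj, Nat.cast_zero]
          linarith
        rw [hzero j h1, hτ.eq_zero j hj]
    · exact hpos j (remaining_pos_of_step hs hj)

theorem exists_exhaustionTimes_probabilisticSerial [Nonempty N] (S : Setting N M)
    (t : N → PrefOrder M) :
    ∃ τ, ExhaustionTimes S t 1 (probabilisticSerial S t).share τ := by
  obtain ⟨τ, hτ, -⟩ := exists_exhaustionTimes S t (Fintype.card M)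
  rw [eatingState_time] at hτ
  exact ⟨τ, hτ⟩

/-! ### Comparison and uniqueness of exhaustion times -/

namespace ExhaustionTimes

variable {S : Setting N M} {u u' : N → PrefOrder M} {T : ℝ} {x x' : N → M → ℝ} {τ τ' : M → ℝ}

/-- If `j` is exhausted strictly later under `τ`, but what `i` prefers to it is not, then an agent
who eats `j` under `τ'` gets strictly more of it under `τ`. -/
theorem share_lt (h : ExhaustionTimes S u T x τ) (h' : ExhaustionTimes S u' T x' τ')
    {i : N} {j : M} (hj : τ' j < τ j) (hx : 0 < x' i j)
    (hle : ∀ k, Prefers (u i) k j → Prefers (u' i) k j ∧ (τ' k < τ' j → τ k ≤ τ' k)) :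
    x' i j < x i j := by
  -- `τ' j - x' i j` is the moment when `i` starts on `j` under `τ'`; by then the better objects are
  -- gone under `τ` as well.
  have h1 := h.sub_le i j (τ' j - x' i j) (by linarith [h'.le_time i j]) fun k hk => by
    have h2 := h'.le_sub i j k (hle k hk).1 hx
    linarith [(hle k hk).2 (by linarith)]
  linarith

/-- Comparison of exhaustion times, on a set `P` of objects that are exhausted first under `τ'`. -/
theorem time_le_time (h : ExhaustionTimes S u T x τ) (h' : ExhaustionTimes S u' T x' τ')
    (P : M → Prop) (hP : ∀ j k, P j → τ' k < τ' j → P k)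
    (hu : ∀ i j k, P j → 0 < x' i j → Prefers (u i) k j → Prefers (u' i) k j)
    (j : M) (hj : P j) : τ j ≤ τ' j := by
  classical
  by_contra! hlt
  obtain ⟨l, hl, hmin⟩ := Finset.exists_min_image
    (Finset.univ.filter fun j => P j ∧ τ' j < τ j) τ' ⟨j, by simp [hj, hlt]⟩
  simp only [Finset.mem_filter, Finset.mem_univ, true_and] at hl hmin
  obtain ⟨hl, hlt⟩ := hl
  have key : ∀ i, 0 < x' i l → x' i l < x i l := fun i hx =>
    h.share_lt h' hlt hx fun k hk => ⟨hu i l k hl hx hk, fun hkl => by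
      by_contra! hk'
      exact absurd (hmin k ⟨hP l k hl hkl, hk'⟩) (not_le.2 hkl)⟩
  have hsum := h'.sum_eq l (hlt.trans_le (h.time_le l))
  have hle : ∀ i ∈ Finset.univ, x' i l ≤ x i l := fun i _ => by
    rcases (h'.nonneg i l).eq_or_lt with h0 | h0
    · rw [← h0]; exact h.nonneg i l
    · exact (key i h0).le
  have heq := (Finset.sum_eq_sum_iff_of_le hle).1
    (le_antisymm (Finset.sum_le_sum hle) ((h.sum_le l).trans hsum.ge))
  have hz : ∀ i ∈ Finset.univ, x' i l = 0 := fun i hi => by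
    by_contra hne
    exact (key i (lt_of_le_of_ne (h'.nonneg i l) (Ne.symm hne))).ne (heq i hi)
  rw [Finset.sum_eq_zero hz] at hsum
  -- Nobody eats `l`, so its capacity is zero; the sums alone would not pin down its time, hence the
  -- field `eq_zero`.
  have h0 : τ l = 0 := h.eq_zero l (by exact_mod_cast hsum.symm)
  linarith [h'.time_nonneg l]

theorem share_le_share (h : ExhaustionTimes S u T x τ) (h' : ExhaustionTimes S u T x' τ)
    (i : N) (j : M) : x i j ≤ x' i j := by
  rcases (h.nonneg i j).eq_or_lt with h0 | h0
  · rw [← h0]; exact h'.nonneg i j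
  · have := h'.sub_le i j (τ j - x i j) (by linarith [h.le_time i j]) fun k hk => by
      linarith [h.le_sub i j k hk h0]
    linarith

/-- Exhaustion times determine the outcome. -/
theorem share_unique (h : ExhaustionTimes S u T x τ) (h' : ExhaustionTimes S u T x' τ') :
    x = x' := by
  have hτ : τ = τ' := funext fun j => le_antisymm
    (h.time_le_time h' (fun _ => True) (fun _ _ _ _ => trivial) (fun _ _ _ _ _ hk => hk) j trivial)
    (h'.time_le_time h (fun _ => True) (fun _ _ _ _ => trivial) (fun _ _ _ _ _ hk => hk) j trivial)
  subst hτ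
  exact funext fun i => funext fun j => le_antisymm (h.share_le_share h' i j)
    (h'.share_le_share h i j)

end ExhaustionTimes

/-! ### Adjacent swaps -/

/-- `v` arises from `w` by moving `b` above its predecessor `a`. -/
structure IsAdjacentSwap (w v : PrefOrder M) (a b : M) : Prop where
  left : Prefers w a b
  right : Prefers v b a
  mono : ∀ k j, Prefers w k j → ¬ (k = a ∧ j = b) → Prefers v k j
  anti : ∀ k j, Prefers v k j → ¬ (k = b ∧ j = a) → Prefers w k j

theorem isAdjacentSwap_of_mem_neighborhood {w v : PrefOrder M} (hv : v ∈ neighborhood w) {a b : M}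
    (hab : Prefers w a b) (hba : Prefers v b a) : IsAdjacentSwap w v a b := by
  obtain ⟨k, hk, rfl⟩ := hv
  have key : ∀ p : Fin (Fintype.card M),
      ((Equiv.swap (⟨k, Nat.lt_of_succ_lt hk⟩ : Fin (Fintype.card M)) ⟨k + 1, hk⟩ p : Fin _) : ℕ) =
        if (p : ℕ) = k then k + 1 else if (p : ℕ) = k + 1 then k else p := fun p => by
    rw [Equiv.swap_apply_def]
    simp only [Fin.ext_iff]
    split_ifs <;> rfl
  have hp : ∀ c d, Prefers ((Equiv.swap (⟨k, Nat.lt_of_succ_lt hk⟩ : Fin (Fintype.card M))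
      ⟨k + 1, hk⟩).trans w) c d ↔
      (if (w.symm c : ℕ) = k then k + 1 else if (w.symm c : ℕ) = k + 1 then k else w.symm c) <
      (if (w.symm d : ℕ) = k then k + 1 else if (w.symm d : ℕ) = k + 1 then k else w.symm d) :=
    fun c d => by
      rw [← key, ← key]
      rfl
  have hw : ∀ c d, Prefers w c d ↔ (w.symm c : ℕ) < w.symm d := fun c d => Iff.rfl
  have hinj : ∀ c d, c = d ↔ (w.symm c : ℕ) = w.symm d := fun c d => by
    rw [← Fin.ext_iff, w.symm.injective.eq_iff]
  have h1 := (hw a b).1 hab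
  have h2 := (hp b a).1 hba
  -- Only the pair in positions `k`, `k + 1` has its order reversed.
  have hpos : (w.symm a : ℕ) = k ∧ (w.symm b : ℕ) = k + 1 := by
    split_ifs at h2 <;> omega
  refine ⟨hab, hba, fun c d h hn => ?_, fun c d h hn => ?_⟩
  · rw [hinj, hinj] at hn
    rw [hw] at h
    rw [hp]
    split_ifs <;> omega
  · rw [hinj, hinj] at hn
    rw [hp] at h
    rw [hw]
    split_ifs at h <;> omega

namespace IsAdjacentSwap

variable {w v : PrefOrder M} {a b : M}

theorem symm (h : IsAdjacentSwap w v a b) : IsAdjacentSwap v w b a :=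
  ⟨h.right, h.left, h.anti, h.mono⟩

theorem ne (h : IsAdjacentSwap w v a b) : a ≠ b := by
  rintro rfl
  exact lt_irrefl _ h.left

theorem prefers_right (h : IsAdjacentSwap w v a b) {k : M} (hk : Prefers w k a) :
    Prefers v k b :=
  h.mono k b (lt_trans hk h.left) fun hc => lt_irrefl _ (hc.1 ▸ hk)

end IsAdjacentSwap

/-! ### Effect of a swap on the outcome -/

namespace ExhaustionTimes

variable {S : Setting N M} {u u' : N → PrefOrder M} {x x' : N → M → ℝ} {τ τ' : M → ℝ}
  {i : N} {a b : M}

/-- The swap adds a better object only for `a` and removes one only for `b`. Until `b` is exhausted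
under `τ'`, no object other than `b` meets an agent with fewer obstacles under `u'` than under `u`,
so `time_le_time` applies. -/
theorem time_le_time_of_swap (h : ExhaustionTimes S u 1 x τ) (h' : ExhaustionTimes S u' 1 x' τ')
    (hu : ∀ i', i' ≠ i → u i' = u' i') (hsw : IsAdjacentSwap (u i) (u' i) a b)
    {j : M} (hjb : j ≠ b) (hj : τ' j ≤ τ' b) : τ j ≤ τ' j := by
  refine h.time_le_time h' (fun j => j ≠ b ∧ τ' j ≤ τ' b) ?_ ?_ j ⟨hjb, hj⟩
  · rintro j k ⟨-, hj⟩ hk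
    exact ⟨by rintro rfl; linarith, by linarith⟩
  · rintro i' j k ⟨hjb, -⟩ - hk
    by_cases hi : i' = i
    · subst hi
      exact hsw.mono k j hk fun hc => hjb hc.2
    · rwa [← hu i' hi]

/-- Agent `i` faces the choice between `a` and `b` at some time `c`. -/
def Competing (w : PrefOrder M) (τ : M → ℝ) (a b : M) : Prop :=
  ∃ c, 0 ≤ c ∧ c < τ a ∧ c < τ b ∧ ∀ k, Prefers w k a → τ k ≤ c

/-- If `b` is exhausted earlier after the swap, every other agent who then eats it would have had
strictly more before. Since `b` is used up after the swap, only `i` can account for the difference.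
-/
theorem share_lt_of_time_lt (h : ExhaustionTimes S u 1 x τ) (h' : ExhaustionTimes S u' 1 x' τ')
    (hu : ∀ i', i' ≠ i → u i' = u' i') (hsw : IsAdjacentSwap (u i) (u' i) a b)
    (hb : τ' b < τ b) : x i b < x' i b := by
  by_contra! hcon
  have key : ∀ i', i' ≠ i → 0 < x' i' b → x' i' b < x i' b := fun i' hi hx =>
    h.share_lt h' hb hx fun k hk => ⟨hu i' hi ▸ hk, fun hkb =>
      h.time_le_time_of_swap h' hu hsw (by rintro rfl; exact lt_irrefl _ hkb) hkb.le⟩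
  have hsum := h'.sum_eq b (hb.trans_le (h.time_le b))
  have hle : ∀ i' ∈ Finset.univ, x' i' b ≤ x i' b := fun i' _ => by
    by_cases hi : i' = i
    · rwa [hi]
    rcases (h'.nonneg i' b).eq_or_lt with h0 | h0
    · rw [← h0]; exact h.nonneg i' b
    · exact (key i' hi h0).le
  have heq := (Finset.sum_eq_sum_iff_of_le hle).1
    (le_antisymm (Finset.sum_le_sum hle) ((h.sum_le b).trans hsum.ge))
  have hz : ∀ i' ∈ Finset.univ, i' ≠ i → x' i' b = 0 := fun i' hi' hi => by
    by_contra hne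
    exact (key i' hi (lt_of_le_of_ne (h'.nonneg i' b) (Ne.symm hne))).ne (heq i' hi')
  rw [Finset.sum_eq_single_of_mem i (Finset.mem_univ i) hz] at hsum
  -- Now `i` alone eats all of `b` under `x'`. Integrality enters here: a nonzero capacity is at
  -- least one unit, too much to finish by `τ' b < τ b ≤ 1`.
  have h0 : S.cap b ≠ 0 := fun h0 => by
    linarith [h.eq_zero b h0, h'.time_nonneg b]
  have h1 : (1 : ℝ) ≤ S.cap b := by exact_mod_cast Nat.one_le_iff_ne_zero.2 h0
  linarith [h'.le_time i b, h.time_le b]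

theorem time_le_of_competing (h : ExhaustionTimes S u 1 x τ) (h' : ExhaustionTimes S u' 1 x' τ')
    (hu : ∀ i', i' ≠ i → u i' = u' i') (hsw : IsAdjacentSwap (u i) (u' i) a b) {c : ℝ}
    (hca : c < τ a) (hc : ∀ k, Prefers (u i) k a → τ k ≤ c) {k : M}
    (hk : Prefers (u' i) k b) : τ' k ≤ c := by
  have hk' := hsw.symm.prefers_right hk
  have hka : k ≠ a := by rintro rfl; exact lt_irrefl _ hk'
  have h1 := hc k hk'
  exact (h'.time_le_time_of_swap h (fun i' hi => (hu i' hi).symm) hsw.symm hka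
    (h1.trans hca.le)).trans h1

theorem share_lt_of_competing (h : ExhaustionTimes S u 1 x τ)
    (h' : ExhaustionTimes S u' 1 x' τ')
    (hu : ∀ i', i' ≠ i → u i' = u' i') (hsw : IsAdjacentSwap (u i) (u' i) a b)
    (hcomp : Competing (u i) τ a b) : x i b < x' i b := by
  obtain ⟨c, hc0, hca, hcb, hc⟩ := hcomp
  rcases lt_or_ge (τ' b) (τ b) with hb | hb
  · exact h.share_lt_of_time_lt h' hu hsw hb
  -- After the swap `i` eats `b` from time `c` at the latest until `τ' b ≥ τ b`; before it, `i`
  -- started on `b` no earlier than `τ a > c`, if at all.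
  · have h1 := h'.sub_le i b c hc0 fun k hk => h.time_le_of_competing h' hu hsw hca hc hk
    rcases (h.nonneg i b).eq_or_lt with h0 | h0
    · linarith
    · linarith [h.le_sub i b a hsw.left h0]

theorem competing_symm (h : ExhaustionTimes S u 1 x τ) (h' : ExhaustionTimes S u' 1 x' τ')
    (hu : ∀ i', i' ≠ i → u i' = u' i') (hsw : IsAdjacentSwap (u i) (u' i) a b)
    (hcomp : Competing (u i) τ a b) : Competing (u' i) τ' b a := by
  have hlt := h.share_lt_of_competing h' hu hsw hcomp
  have hpos := (h.nonneg i b).trans_lt hlt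
  obtain ⟨c, hc0, hca, hcb, hc⟩ := hcomp
  -- Both terms bound the times under `τ'` of what `i` ranks above `b`: `c` by comparison with `τ`,
  -- the other because `i` starts on `b` then. The first stays below `τ' a` when `a` goes no later
  -- than `b`, the second otherwise.
  have hb : min c (τ' b - x' i b) < τ' b := (min_le_right _ _).trans_lt (by linarith)
  refine ⟨min c (τ' b - x' i b), le_min hc0 (by linarith [h'.le_time i b]), hb, ?_, fun k hk =>
    le_min (h.time_le_of_competing h' hu hsw hca hc hk) (by linarith [h'.le_sub i b k hk hpos])⟩
  rcases le_or_gt (τ' a) (τ' b) with hab | hab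
  · exact (min_le_left _ _).trans_lt
      (hca.trans_le (h.time_le_time_of_swap h' hu hsw hsw.ne hab))
  · exact hb.trans hab

theorem of_not_competing (h : ExhaustionTimes S u 1 x τ)
    (hu : ∀ i', i' ≠ i → u i' = u' i') (hsw : IsAdjacentSwap (u i) (u' i) a b)
    (hcomp : ¬ Competing (u i) τ a b) : ExhaustionTimes S u' 1 x τ := by
  have hn : ∀ c, 0 ≤ c → (∀ k, Prefers (u i) k a → τ k ≤ c) → τ a ≤ c ∨ τ b ≤ c := by
    intro c hc0 hc
    by_contra! hcon
    exact hcomp ⟨c, hc0, hcon.1, hcon.2, hc⟩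
  refine { h with le_sub := fun i' j k hk hx => ?_, sub_le := fun i' j c hc0 hc => ?_ }
  · by_cases hi : i' = i
    · subst hi
      by_cases hc : k = b ∧ j = a
      · obtain ⟨rfl, rfl⟩ := hc
        -- When `i'` starts on `a`, everything better is gone and `a` is not; without competition
        -- `b` must be gone too.
        rcases hn (τ j - x i' j) (by linarith [h.le_time i' j])
          (fun l hl => by linarith [h.le_sub i' j l hl hx]) with h1 | h1 <;> linarith
      · exact h.le_sub i' j k (hsw.anti k j hk hc) hx
    · exact h.le_sub i' j k (by rwa [hu i' hi]) hx
  · by_cases hi : i' = i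
    · subst hi
      by_cases hj : j = b
      · subst hj
        -- Under the new order `a` no longer precedes `b`. Either `a` is gone by `c` anyway and the
        -- old bound applies, or `b` is gone and the bound is trivial.
        rcases hn c hc0 fun k hk => hc k (hsw.prefers_right hk) with h1 | h1
        · refine h.sub_le i' j c hc0 fun k hk => ?_
          by_cases hka : k = a
          · rwa [hka]
          · exact hc k (hsw.mono k j hk fun hc => hka hc.1)
        · linarith [h.nonneg i' j]
      · exact h.sub_le i' j c hc0 fun k hk => hc k (hsw.mono k j hk fun hc => hj hc.2)
    · exact h.sub_le i' j c hc0 fun k hk => hc k (by rwa [← hu i' hi])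

end ExhaustionTimes

end OneSidedMatching

theorem mainTheorem5 {N M : Type*} [Fintype N] [Fintype M] (S : OneSidedMatching.Setting N M) :
    OneSidedMatching.SwapMonotonic (OneSidedMatching.probabilisticSerial S) := by
  classical
  intro i t t' ht' a b hab hba
  have : Nonempty N := ⟨i⟩
  obtain ⟨τ, h⟩ := OneSidedMatching.exists_exhaustionTimes_probabilisticSerial S t
  obtain ⟨τ', h'⟩ := OneSidedMatching.exists_exhaustionTimes_probabilisticSerial S
    (Function.update t i t')
  set u' := Function.update t i t' with hu'
  have hu : ∀ i', i' ≠ i → t i' = u' i' := fun i' hi => by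
    rw [hu', Function.update_of_ne hi]
  have hsw : OneSidedMatching.IsAdjacentSwap (t i) (u' i) a b := by
    rw [hu', Function.update_self]
    exact OneSidedMatching.isAdjacentSwap_of_mem_neighborhood ht' hab hba
  by_cases hcomp : OneSidedMatching.ExhaustionTimes.Competing (t i) τ a b
  · exact Or.inr ⟨h'.share_lt_of_competing h (fun i' hi => (hu i' hi).symm) hsw.symm
      (h.competing_symm h' hu hsw hcomp), h.share_lt_of_competing h' hu hsw hcomp⟩
  · exact Or.inl (congrFun ((h.of_not_competing hu hsw hcomp).share_unique h') i)
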